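/- Let $\mathcal A$ be a unital $\mathbb C$-algebra with a linear functional $\varphi$, $\varphi(1_{\mathcal A})=1$, and let $\mathcal F$ be a (not necessarily unital) $\mathbb C$-algebra with a linear functional $\Phi$, such that $\mathcal F$ is a (unital) $\mathcal A$-bimodule whose actions are compatible with the multiplication of $\mathcal F$ and with scalars (i.e. $(af)g=a(fg)$, $(fa)g=f(ag)$, $(fg)a=f(ga)$). Let $\mathcal B=\mathcal A\oplus\mathcal F$ be the unital algebra with multiplication $(a_1,f_1)(a_2,f_2)=(a_1a_2,\;a_1f_2+f_1a_2+f_1f_2)$, with the functionals $\varphi(a,f):=\varphi(a)$ and $\varphi'(a,f):=\Phi(f)$. Let $(\mathcal A_i)_{i\in I}$ be subalgebras of $\mathcal A$ containing $1_{\mathcal A}$ and $(\mathcal F_j)_{j\in J}$ subalgebras of $\mathcal F$; let $\langle\mathcal A_i: i\in I\rangle$ be the unital subalgebra of $\mathcal A$ generated by the $\mathcal A_i$ and $\langle\mathcal F_j: j\in J\rangle$ the subalgebra of $\mathcal F$ generated by the $\mathcal F_j$. Call a finite sequence of indices alternating if neighbouring indices are distinct. * The $\mathcal A_i$ are *free*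 if $\varphi(a_1\cdots a_n)=0$ for all $n\ge1$, alternating $(i_1,\dots,i_n)$ and $a_k\in\mathcal A_{i_k}$ with $\varphi(a_k)=0$. * The $\mathcal F_j$ are *trivially independent* if $\Phi(f_1\cdots f_n)=0$ for all $n\ge2$, alternating $(j_1,\dots,j_n)$ and $f_k\in\mathcal F_{j_k}$. * A unital subalgebra $\mathcal A_0\subseteq\mathcal A$ and a subalgebra $\mathcal F_0\subseteq\mathcal F$ are *cyclic-antimonotone independent* if $\Phi(a_0f_1a_1\cdots f_na_n)=\varphi(a_0a_n)\big[\prod_{k=1}^{n-1}\varphi(a_k)\big]\Phi(f_1\cdots f_n)$ for all $n\ge1$, $a_k\in\mathcal A_0$, $f_k\in\mathcal F_0$. * $((\mathcal A_i)_{i\in I},(\mathcal F_j)_{j\in J})$ is *weakly B$'$-free* if the $\mathcal A_i$ are free and $(\langle\mathcal A_i: i\in I\rangle,\langle\mathcal F_j: j\in J\rangle)$ is cyclic-antimonotone independent; it is *B$'$-free* if moreover the $\mathcal F_j$ are trivially independent. * Subalgebras $(\mathcal B_k)_{k\in K}$ of $\mathcal B$ containing the unit are *infinitesimally free* if for all $n\ge1$,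 alternating $(k_1,\dots,k_n)$ and $b_l\in\mathcal B_{k_l}$ with $\varphi(b_l)=0$ one has $\varphi(b_1\cdots b_n)=0$, and $\varphi'(b_1\cdots b_n)$ equals $\varphi(b_1b_n)\varphi(b_2b_{n-1})\cdots\varphi(b_{(n-1)/2}b_{(n+3)/2})\,\varphi'(b_{(n+1)/2})$ if $n$ is odd and $k_l=k_{n+1-l}$ for all $l$, and $0$ otherwise. Put $\mathcal A_i':=\mathcal A_i\oplus 0$, $\mathcal F_j':=\mathbb C1_{\mathcal A}\oplus\mathcal F_j$ and $\mathcal F':=\mathbb C1_{\mathcal A}\oplus\langle\mathcal F_j: j\in J\rangle$, which are subalgebras of $\mathcal B$ containing its unit. **Theorem 3.4.** 1. $((\mathcal A_i)_{i\in I},(\mathcal F_j)_{j\in J})$ is B$'$-free if and only if the family consisting of all $\mathcal A_i'$ $(i\in I)$ and all $\mathcal F_j'$ $(j\in J)$ is infinitesimally free in $(\mathcal B,\varphi,\varphi')$. 2. $\mathcal F'$ is the unital subalgebra of $\mathcal B$ generated by the $\mathcal F_j'$ $(j\in J)$; and $((\mathcal A_i)_{i\in I},(\mathcal F_j)_{j\in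 J})$ is weakly B$'$-free if and only if the family consisting of all $\mathcal A_i'$ $(i\in I)$ together with the single subalgebra $\mathcal F'$ is infinitesimally free in $(\mathcal B,\varphi,\varphi')$. -/

import Mathlib

open MulOpposite

set_option linter.unusedSectionVars false

namespace BPrime

/-! ### Algebras over a unital algebra -/

/-- `F` is an algebra over the (noncommutative) unital algebra `A`: the left and right actions of `A`
form a bimodule structure which is consistent with the multiplication of `F`.  The right action
`f a` is Mathlib's `op a • f`.  The fields are, in order, `a (f b) = (a f) b`, `(a f) g = a (f g)`,
`f (g a) = (f g) a` and `(f a) g = f (a g)`. -/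
class IsAlgebraOver (A F : Type*) [Ring A] [NonUnitalRing F] [Module A F] [Module Aᵐᵒᵖ F] :
    Prop where
  smul_op_smul : ∀ (a b : A) (f : F), a • op b • f = op b • a • f
  smul_mul : ∀ (a : A) (f g : F), (a • f) * g = a • (f * g)
  mul_op_smul : ∀ (f g : F) (a : A), f * (op a • g) = op a • (f * g)
  op_smul_mul : ∀ (f : F) (a : A) (g : F), (op a • f) * g = f * (a • g)

/-! ### Words -/

/-- Neighbouring indices are distinct. -/
def Alternating {I : Type*} {n : ℕ} (i : Fin n → I) : Prop :=
  ∀ k l : Fin n, (k : ℕ) + 1 = (l : ℕ) → i k ≠ i l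

/-- The product `f₀ f₁ ⋯ fₙ` of a non-empty word in an algebra which need not have a unit. -/
def wordProd {F : Type*} [Mul F] : {n : ℕ} → (Fin (n + 1) → F) → F
  | 0, f => f 0
  | _ + 1, f => f 0 * wordProd (fun k => f k.succ)

/-- The element `a₀ f₁ a₁ f₂ a₂ ⋯ fₙ aₙ = a₀ (f₁ a₁) (f₂ a₂) ⋯ (fₙ aₙ)` of `F`, where the number
of factors from `F` is `n = m + 1 ≥ 1`. -/
def mixedWord {A F : Type*} [Ring A] [NonUnitalRing F] [Module A F] [Module Aᵐᵒᵖ F] {m : ℕ}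
    (a : Fin (m + 2) → A) (f : Fin (m + 1) → F) : F :=
  a 0 • wordProd (fun k : Fin (m + 1) => op (a k.succ) • f k)

/-! ### Notions of independence -/

/-- Free independence of unital subalgebras with respect to `φ`. -/
def Free {A : Type*} [Ring A] [Algebra ℂ A] (φ : A →ₗ[ℂ] ℂ) {I : Type*}
    (𝒜 : I → Subalgebra ℂ A) : Prop :=
  ∀ (n : ℕ) (i : Fin n → I) (a : Fin n → A), 0 < n → Alternating i →
    (∀ k, a k ∈ 𝒜 (i k) ∧ φ (a k) = 0) → φ (List.ofFn a).prod = 0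

/-- Infinitesimal freeness of unital subalgebras with respect to `(φ, φ')`.  Positions in a word are
counted from `0`, so that the mirror image of position `k` is `k.rev` and the middle of a word of
odd length `n` is position `n / 2`. -/
def InfinitesimallyFree {B : Type*} [Ring B] [Algebra ℂ B] (φ φ' : B →ₗ[ℂ] ℂ) {I : Type*}
    (ℬ : I → Subalgebra ℂ B) : Prop :=
  ∀ (n : ℕ) (i : Fin n → I) (b : Fin n → B) (hn : 0 < n), Alternating i →
    (∀ k, b k ∈ ℬ (i k) ∧ φ (b k) = 0) →
      φ (List.ofFn b).prod = 0 ∧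
      ((Odd n ∧ ∀ k, i k = i k.rev) →
        φ' (List.ofFn b).prod =
          (∏ k : Fin (n / 2),
              φ (b (k.castLE (Nat.div_le_self n 2)) * b (k.castLE (Nat.div_le_self n 2)).rev)) *
            φ' (b ⟨n / 2, Nat.div_lt_self hn one_lt_two⟩)) ∧
      (¬ (Odd n ∧ ∀ k, i k = i k.rev) → φ' (List.ofFn b).prod = 0)

/-- Trivial independence of subalgebras with respect to `Φ`: words of length at least two in
alternating subalgebras are annihilated by `Φ`. -/
def TriviallyIndependent {F : Type*} [NonUnitalRing F] [Module ℂ F] (Φ : F →ₗ[ℂ] ℂ)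
    {J : Type*} (ℱ : J → NonUnitalSubalgebra ℂ F) : Prop :=
  ∀ (n : ℕ) (j : Fin (n + 2) → J) (f : Fin (n + 2) → F), Alternating j →
    (∀ k, f k ∈ ℱ (j k)) → Φ (wordProd f) = 0

section

variable {A F : Type*} [Ring A] [Algebra ℂ A] [NonUnitalRing F] [Module ℂ F]
  [IsScalarTower ℂ F F] [SMulCommClass ℂ F F] [Module A F] [Module Aᵐᵒᵖ F]

/-- Cyclic-antimonotone independence of a unital subalgebra of `A` and a subalgebra of `F`:
`Φ (a₀ f₁ a₁ ⋯ fₙ aₙ) = φ (a₀ aₙ) φ (a₁) ⋯ φ (aₙ₋₁) Φ (f₁ ⋯ fₙ)` for all `n = m + 1 ≥ 1`. -/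
def CyclicAntimonotone (φ : A →ₗ[ℂ] ℂ) (Φ : F →ₗ[ℂ] ℂ) (A₁ : Subalgebra ℂ A)
    (F₁ : NonUnitalSubalgebra ℂ F) : Prop :=
  ∀ (m : ℕ) (a : Fin (m + 2) → A) (f : Fin (m + 1) → F), (∀ k, a k ∈ A₁) → (∀ k, f k ∈ F₁) →
    Φ (mixedWord a f) =
      φ (a 0 * a (Fin.last (m + 1))) * (∏ k : Fin m, φ (a k.succ.castSucc)) * Φ (wordProd f)

/-- Weak B′-freeness; the suprema are the subalgebras generated by the two families. -/
def WeaklyBPrimeFree (φ : A →ₗ[ℂ] ℂ) (Φ : F →ₗ[ℂ] ℂ) {I J : Type*}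
    (𝒜 : I → Subalgebra ℂ A) (ℱ : J → NonUnitalSubalgebra ℂ F) : Prop :=
  Free φ 𝒜 ∧ CyclicAntimonotone φ Φ (⨆ i, 𝒜 i) (⨆ j, ℱ j)

/-- B′-freeness. -/
def BPrimeFree (φ : A →ₗ[ℂ] ℂ) (Φ : F →ₗ[ℂ] ℂ) {I J : Type*}
    (𝒜 : I → Subalgebra ℂ A) (ℱ : J → NonUnitalSubalgebra ℂ F) : Prop :=
  WeaklyBPrimeFree φ Φ 𝒜 ℱ ∧ TriviallyIndependent Φ ℱ

end

/-! ### The associated infinitesimal noncommutative probability space -/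

/-- The vector space `A ⊕ F`, on which the type B′ multiplication is put below. -/
def Assoc (A F : Type*) : Type _ := A × F

namespace Assoc

/-- The main term. -/
def main {A F : Type*} (x : Assoc A F) : A := x.1

/-- The perturbation term. -/
def pert {A F : Type*} (x : Assoc A F) : F := x.2

/-- The element `(a, f)`, that is, `a + f`. -/
def mk {A F : Type*} (a : A) (f : F) : Assoc A F := (a, f)

@[simp] theorem main_mk {A F : Type*} (a : A) (f : F) : (mk a f).main = a := rfl

@[simp] theorem pert_mk {A F : Type*} (a : A) (f : F) : (mk a f).pert = f := rfl

theorem ext {A F : Type*} {x y : Assoc A F} (h₁ : x.main = y.main) (h₂ : x.pert = y.pert) :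
    x = y :=
  Prod.ext h₁ h₂

instance {A F : Type*} [Ring A] [NonUnitalRing F] : AddCommGroup (Assoc A F) :=
  inferInstanceAs (AddCommGroup (A × F))

instance {A F : Type*} [Ring A] [NonUnitalRing F] : One (Assoc A F) := ⟨mk 1 0⟩

/-- The multiplication `(a₁, f₁) (a₂, f₂) = (a₁ a₂, a₁ f₂ + f₁ a₂ + f₁ f₂)`. -/
instance {A F : Type*} [Ring A] [NonUnitalRing F] [Module A F] [Module Aᵐᵒᵖ F] :
    Mul (Assoc A F) :=
  ⟨fun x y => mk (x.main * y.main)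
    (x.main • y.pert + op y.main • x.pert + x.pert * y.pert)⟩

section basic

variable {A F : Type*} [Ring A] [NonUnitalRing F] (x y : Assoc A F)

@[simp] theorem main_zero : (0 : Assoc A F).main = 0 := rfl
@[simp] theorem pert_zero : (0 : Assoc A F).pert = 0 := rfl
@[simp] theorem main_one : (1 : Assoc A F).main = 1 := rfl
@[simp] theorem pert_one : (1 : Assoc A F).pert = 0 := rfl
@[simp] theorem main_add : (x + y).main = x.main + y.main := rfl
@[simp] theorem pert_add : (x + y).pert = x.pert + y.pert := rfl
@[simp] theorem main_mul [Module A F] [Module Aᵐᵒᵖ F] : (x * y).main = x.main * y.main := rfl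
@[simp] theorem pert_mul [Module A F] [Module Aᵐᵒᵖ F] :
    (x * y).pert = x.main • y.pert + op y.main • x.pert + x.pert * y.pert := rfl

end basic

instance {A F : Type*} [Ring A] [NonUnitalRing F] [Module A F] [Module Aᵐᵒᵖ F]
    [IsAlgebraOver A F] : Ring (Assoc A F) where
  __ := (inferInstance : AddCommGroup (Assoc A F))
  one_mul x := ext (by simp) (by simp)
  mul_one x := ext (by simp) (by simp)
  zero_mul x := ext (by simp) (by simp)
  mul_zero x := ext (by simp) (by simp)
  left_distrib x y z := ext (by simp [mul_add]) (by simp [mul_add, add_smul]; abel)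
  right_distrib x y z := ext (by simp [add_mul]) (by simp [add_mul, add_smul]; abel)
  mul_assoc x y z := ext (by simp [mul_assoc]) (by
    simp only [main_mul, pert_mul, mul_smul, op_mul, smul_add, mul_add, add_mul,
      IsAlgebraOver.smul_op_smul, IsAlgebraOver.smul_mul, IsAlgebraOver.mul_op_smul,
      IsAlgebraOver.op_smul_mul, mul_assoc]
    abel)

variable {A F : Type*} [Ring A] [Algebra ℂ A] [NonUnitalRing F] [Module ℂ F]
  [IsScalarTower ℂ F F] [SMulCommClass ℂ F F] [Module A F] [Module Aᵐᵒᵖ F]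
  [IsScalarTower ℂ A F] [IsScalarTower ℂ Aᵐᵒᵖ F] [IsAlgebraOver A F]

instance : Module ℂ (Assoc A F) :=
  inferInstanceAs (Module ℂ (A × F))

@[simp] theorem main_smul (c : ℂ) (x : Assoc A F) : (c • x).main = c • x.main := rfl

@[simp] theorem pert_smul (c : ℂ) (x : Assoc A F) : (c • x).pert = c • x.pert := rfl

instance : Algebra ℂ (Assoc A F) :=
  Algebra.ofModule
    (fun c x y => ext (by simp) (by
      have h : op (y.main) • c • x.pert = c • op (y.main) • x.pert := by
        rw [← algebraMap_smul Aᵐᵒᵖ c x.pert, ← mul_smul, ← Algebra.commutes, mul_smul,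
          algebraMap_smul]
      simp [smul_add, smul_assoc, h, smul_mul_assoc]))
    (fun c x y => ext (by simp) (by
      have h : x.main • c • y.pert = c • x.main • y.pert := by
        rw [← algebraMap_smul A c y.pert, ← mul_smul, ← Algebra.commutes, mul_smul,
          algebraMap_smul]
      simp [smul_add, smul_assoc, h, op_smul, mul_smul_comm]))

variable (F) in
/-- The functional `φ` on `A ⊕ F`: `φ (a + f) = φ a`. -/
def phi (φ : A →ₗ[ℂ] ℂ) : Assoc A F →ₗ[ℂ] ℂ where
  toFun x := φ x.main
  map_add' x y := by simp
  map_smul' c x := by simp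

variable (A) in
/-- The functional `φ'` on `A ⊕ F`: `φ' (a + f) = Φ f`. -/
def phi' (Φ : F →ₗ[ℂ] ℂ) : Assoc A F →ₗ[ℂ] ℂ where
  toFun x := Φ x.pert
  map_add' x y := by simp
  map_smul' c x := by simp

theorem phi_one (φ : A →ₗ[ℂ] ℂ) (h : φ 1 = 1) : phi F φ 1 = 1 := h

theorem phi'_one (Φ : F →ₗ[ℂ] ℂ) : phi' A Φ 1 = 0 := map_zero Φ

theorem algebraMap_eq (c : ℂ) : algebraMap ℂ (Assoc A F) c = mk (algebraMap ℂ A c) 0 := by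
  rw [Algebra.algebraMap_eq_smul_one, Algebra.algebraMap_eq_smul_one]
  exact ext (by simp) (by simp)

variable (F) in
/-- The subalgebra `A₁ ⊕ 0`. -/
def mainSubalgebra (A₁ : Subalgebra ℂ A) : Subalgebra ℂ (Assoc A F) where
  carrier := {x | x.main ∈ A₁ ∧ x.pert = 0}
  mul_mem' := fun {x y} hx hy => ⟨A₁.mul_mem hx.1 hy.1, by simp [hx.2, hy.2]⟩
  add_mem' := fun {x y} hx hy => ⟨A₁.add_mem hx.1 hy.1, by simp [hx.2, hy.2]⟩
  algebraMap_mem' := fun c => by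
    rw [algebraMap_eq]
    exact ⟨A₁.algebraMap_mem c, rfl⟩

variable (A) in
/-- The subalgebra `ℂ 1 ⊕ F₁`. -/
def pertSubalgebra (F₁ : NonUnitalSubalgebra ℂ F) : Subalgebra ℂ (Assoc A F) where
  carrier := {x | (∃ c : ℂ, x.main = c • 1) ∧ x.pert ∈ F₁}
  mul_mem' := by
    rintro x y ⟨⟨c, hc⟩, hx⟩ ⟨⟨d, hd⟩, hy⟩
    refine ⟨⟨c * d, by simp [hc, hd, smul_smul, mul_comm]⟩, ?_⟩
    have h : (x * y).pert = c • y.pert + d • x.pert + x.pert * y.pert := by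
      simp [hc, hd, smul_assoc]
    rw [h]
    exact F₁.add_mem (F₁.add_mem (F₁.smul_mem' c hy) (F₁.smul_mem' d hx)) (F₁.mul_mem hx hy)
  add_mem' := by
    rintro x y ⟨⟨c, hc⟩, hx⟩ ⟨⟨d, hd⟩, hy⟩
    exact ⟨⟨c + d, by simp [hc, hd, add_smul]⟩, F₁.add_mem hx hy⟩
  algebraMap_mem' := fun c => by
    rw [algebraMap_eq]
    exact ⟨⟨c, Algebra.algebraMap_eq_smul_one c⟩, F₁.zero_mem⟩

end Assoc

end BPrime

/-!
The subalgebras `𝒜 i ⊕ 0` and `ℂ 1 ⊕ ℱ j` of `A ⊕ F` have as centred elements the centred elements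
of `𝒜 i` and all elements of `ℱ j`.  Hence infinitesimal freeness is a statement about alternating
words in such letters, and `WordRule` sorts it by the number of letters from `F`
(`infinitesimallyFree_iff_wordRule`):

* without such letters it says that the `𝒜 i` are free;
* with exactly one, `φ' (a₁ ⋯ aₘ f b₁ ⋯ bₗ)` is `Φ f` times the letterwise pairing of `aₘ, …, a₁`
  with `b₁, …, bₗ`, which for free `𝒜 i` is `φ (a₁ ⋯ aₘ b₁ ⋯ bₗ)` (`FreeWords.apply_reverse_mul`);
* with at least two, `φ'` vanishes, as one of them is not in the middle and makes a factor of the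
  product formula zero.

Cyclic-antimonotone independence says that `Φ (a f₁ a₁ ⋯ fₙ b)` is `φ (a b)` times the value of `Φ`
on the word `f₁ a₁ ⋯ fₙ` with each inner `aₖ` replaced by the scalar `φ aₖ`.  Both words are
multilinear in their entries, and they are handled together as one element of the ring
`(A ⊕ F) × (A ⊕ F)`: an entry `a` becomes `(a, φ a)`, an entry `f` becomes `(f, f)`.  For a centred
letter from `A` this pair is `(a, 0)`, so the pair of a centred word is a product over its letters
(`twinMain_prod`).  Alternating centred words span the algebra generated by the `𝒜 i`
(`iSup_le_span_reduced`), and prepending entries one at a time, merging neighbours from the same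
`ℱ j`, shows that every mixed word over the generated algebras is a combination of centred
alternating words which begin and end in `F` (`midWord_mem_span`); conversely each such word is a
mixed word (`IsCore.exists_midWord`).  On those words cyclic-antimonotone and trivial independence
together amount to the second and third case above (`bPrimeFree_iff_wordRule`).

Weak B′-freeness is B′-freeness for the single subalgebra generated by the `ℱ j`, for which trivial
independence is an empty condition.
-/

namespace BPrime

open Assoc

variable {A F : Type*} [Ring A] [Algebra ℂ A] [NonUnitalRing F] [Module ℂ F]
  [IsScalarTower ℂ F F] [SMulCommClass ℂ F F] [Module A F] [Module Aᵐᵒᵖ F]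
  [IsScalarTower ℂ A F] [IsScalarTower ℂ Aᵐᵒᵖ F] [IsAlgebraOver A F] {I J : Type*}

/-! ### The two embeddings into the associated algebra -/

variable (F) in
/-- The embedding `a ↦ (a, 0)`. -/
def ofMain : A →ₐ[ℂ] Assoc A F where
  toFun a := mk a 0
  map_one' := rfl
  map_mul' a b := Assoc.ext (by simp) (by simp)
  map_zero' := rfl
  map_add' a b := Assoc.ext (by simp) (by simp)
  commutes' c := (algebraMap_eq c).symm

variable (A) in
/-- The embedding `f ↦ (0, f)`. -/
def ofPert : F →ₗ[ℂ] Assoc A F where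
  toFun f := mk 0 f
  map_add' f g := Assoc.ext (by simp) (by simp)
  map_smul' c f := Assoc.ext (by simp) (by simp)

@[simp] theorem main_ofMain (a : A) : (ofMain F a).main = a := rfl
@[simp] theorem pert_ofMain (a : A) : (ofMain F a).pert = 0 := rfl
@[simp] theorem main_ofPert (f : F) : (ofPert A f).main = 0 := rfl
@[simp] theorem pert_ofPert (f : F) : (ofPert A f).pert = f := rfl

theorem ofPert_mul (f g : F) : ofPert A (f * g) = ofPert A f * ofPert A g :=
  Assoc.ext (by simp) (by simp)

theorem ofMain_mul_ofPert (a : A) (f : F) : ofMain F a * ofPert A f = ofPert A (a • f) :=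
  Assoc.ext (by simp) (by simp)

theorem ofPert_mul_ofMain (a : A) (f : F) : ofPert A f * ofMain F a = ofPert A (op a • f) :=
  Assoc.ext (by simp) (by simp)

@[simp] theorem phi_apply (φ : A →ₗ[ℂ] ℂ) (x : Assoc A F) : phi F φ x = φ x.main := rfl
@[simp] theorem phi'_apply (Φ : F →ₗ[ℂ] ℂ) (x : Assoc A F) : phi' A Φ x = Φ x.pert := rfl

/-! ### Generation by the perturbation parts -/

theorem pertSubalgebra_mono {F₁ F₂ : NonUnitalSubalgebra ℂ F} (h : F₁ ≤ F₂) :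
    pertSubalgebra A F₁ ≤ pertSubalgebra A F₂ :=
  fun _ hx => ⟨hx.1, h hx.2⟩

theorem pertSubalgebra_iSup (ℱ : J → NonUnitalSubalgebra ℂ F) :
    pertSubalgebra A (⨆ j, ℱ j) = ⨆ j, pertSubalgebra A (ℱ j) := by
  apply le_antisymm
  · let T : NonUnitalSubalgebra ℂ F :=
      { carrier := {f | ofPert A f ∈ ⨆ j, pertSubalgebra A (ℱ j)}
        add_mem' := fun {f g} hf hg => by
          simpa only [Set.mem_ofPred_eq, map_add] using Subalgebra.add_mem _ hf hg
        zero_mem' := by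
          simp only [Set.mem_ofPred_eq, map_zero]
          exact Subalgebra.zero_mem _
        mul_mem' := fun {f g} hf hg => by
          simpa only [Set.mem_ofPred_eq, ofPert_mul] using Subalgebra.mul_mem _ hf hg
        smul_mem' := fun c f hf => by
          simpa only [Set.mem_ofPred_eq, map_smul] using Subalgebra.smul_mem _ hf c }
    have hT : ⨆ j, ℱ j ≤ T := iSup_le fun j f hf =>
      (le_iSup (fun j => pertSubalgebra A (ℱ j)) j : _) ⟨⟨0, by simp⟩, hf⟩
    rintro x ⟨⟨c, hc⟩, hx⟩
    have : x = algebraMap ℂ (Assoc A F) c + ofPert A x.pert := by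
      rw [algebraMap_eq, Algebra.algebraMap_eq_smul_one, ← hc]
      exact Assoc.ext (by simp) (by simp)
    rw [this]
    exact Subalgebra.add_mem _ (Subalgebra.algebraMap_mem _ c) (hT hx)
  · exact iSup_le fun j => pertSubalgebra_mono (le_iSup ℱ j)

/-! ### Centred words -/

/-- A centred alternating word in the subalgebras `𝒜 i`. -/
def IsReduced (φ : A →ₗ[ℂ] ℂ) (𝒜 : I → Subalgebra ℂ A) (p : List (I × A)) : Prop :=
  p.IsChain (fun x y => x.1 ≠ y.1) ∧ ∀ x ∈ p, x.2 ∈ 𝒜 x.1 ∧ φ x.2 = 0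

/-- The family a letter is taken from. -/
def index : (I × A) ⊕ (J × F) → I ⊕ J := Sum.map Prod.fst Prod.fst

/-- A letter is centred if it is a centred element of some `𝒜 i` or any element of some `ℱ j`. -/
def IsLetter (φ : A →ₗ[ℂ] ℂ) (𝒜 : I → Subalgebra ℂ A) (ℱ : J → NonUnitalSubalgebra ℂ F) :
    (I × A) ⊕ (J × F) → Prop
  | .inl x => x.2 ∈ 𝒜 x.1 ∧ φ x.2 = 0
  | .inr y => y.2 ∈ ℱ y.1

/-- A centred alternating word in the subalgebras `𝒜 i` and `ℱ j` together. -/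
def IsWord (φ : A →ₗ[ℂ] ℂ) (𝒜 : I → Subalgebra ℂ A) (ℱ : J → NonUnitalSubalgebra ℂ F)
    (w : List ((I × A) ⊕ (J × F))) : Prop :=
  w.IsChain (fun x y => index x ≠ index y) ∧ ∀ x ∈ w, IsLetter φ 𝒜 ℱ x

/-- The element of the associated algebra that a letter stands for. -/
def letter : (I × A) ⊕ (J × F) → Assoc A F
  | .inl x => ofMain F x.2
  | .inr y => ofPert A y.2

/-- The product of a word. -/
def eval (w : List ((I × A) ⊕ (J × F))) : Assoc A F := (w.map letter).prod

@[simp] theorem eval_nil : eval ([] : List ((I × A) ⊕ (J × F))) = 1 := rfl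

@[simp] theorem eval_cons (x : (I × A) ⊕ (J × F)) (w : List ((I × A) ⊕ (J × F))) :
    eval (x :: w) = letter x * eval w := by simp [eval]

@[simp] theorem eval_append (v w : List ((I × A) ⊕ (J × F))) :
    eval (v ++ w) = eval v * eval w := by simp [eval]

@[simp] theorem eval_map_inl (p : List (I × A)) :
    eval (p.map (Sum.inl : _ → (I × A) ⊕ (J × F))) = ofMain F (p.map Prod.snd).prod := by
  induction p with
  | nil => simp
  | cons x p ih => simp [ih, letter]

theorem isReduced_nil (φ : A →ₗ[ℂ] ℂ) (𝒜 : I → Subalgebra ℂ A) : IsReduced φ 𝒜 [] :=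
  ⟨List.IsChain.nil, by simp⟩

section
variable {φ : A →ₗ[ℂ] ℂ} {𝒜 : I → Subalgebra ℂ A} {ℱ : J → NonUnitalSubalgebra ℂ F}

theorem isWord_map_inl {p : List (I × A)} : IsWord φ 𝒜 ℱ (p.map Sum.inl) ↔ IsReduced φ 𝒜 p := by
  rw [IsWord, IsReduced, List.isChain_map]
  simp only [index, List.forall_mem_map, IsLetter, Sum.map_inl, ne_eq, Sum.inl.injEq]

theorem isReduced_append {p q : List (I × A)} : IsReduced φ 𝒜 (p ++ q) ↔
    IsReduced φ 𝒜 p ∧ IsReduced φ 𝒜 q ∧ ∀ x ∈ p.getLast?, ∀ y ∈ q.head?, x.1 ≠ y.1 := by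
  simp only [IsReduced, List.isChain_append, List.mem_append, or_imp, forall_and]
  tauto

theorem isReduced_cons {x : I × A} {p : List (I × A)} : IsReduced φ 𝒜 (x :: p) ↔
    (x.2 ∈ 𝒜 x.1 ∧ φ x.2 = 0) ∧ (∀ y ∈ p.head?, x.1 ≠ y.1) ∧ IsReduced φ 𝒜 p := by
  simp only [IsReduced, List.isChain_cons, List.mem_cons, forall_eq_or_imp]
  tauto

theorem isReduced_reverse {p : List (I × A)} : IsReduced φ 𝒜 p.reverse ↔ IsReduced φ 𝒜 p := by
  simp [IsReduced, List.isChain_reverse, ne_comm]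

theorem isWord_append {p q : List ((I × A) ⊕ (J × F))} : IsWord φ 𝒜 ℱ (p ++ q) ↔
    IsWord φ 𝒜 ℱ p ∧ IsWord φ 𝒜 ℱ q ∧
      ∀ x ∈ p.getLast?, ∀ y ∈ q.head?, index x ≠ index y := by
  simp only [IsWord, List.isChain_append, List.mem_append, or_imp, forall_and]
  tauto

theorem isWord_cons {x : (I × A) ⊕ (J × F)} {p : List ((I × A) ⊕ (J × F))} :
    IsWord φ 𝒜 ℱ (x :: p) ↔
      IsLetter φ 𝒜 ℱ x ∧ (∀ y ∈ p.head?, index x ≠ index y) ∧ IsWord φ 𝒜 ℱ p := by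
  simp only [IsWord, List.isChain_cons, List.mem_cons, forall_eq_or_imp]
  tauto

/-- Words over `A` on both sides of a word which begins and ends in `F` are subject to no matching
condition. -/
theorem isWord_sandwich {p q : List (I × A)} {w : List ((I × A) ⊕ (J × F))}
    (hp : IsReduced φ 𝒜 p) (hq : IsReduced φ 𝒜 q) (hw : IsWord φ 𝒜 ℱ w) (hw0 : w ≠ [])
    (h₁ : ∀ x ∈ w.head?, x.isRight) (h₂ : ∀ x ∈ w.getLast?, x.isRight) :
    IsWord φ 𝒜 ℱ (p.map Sum.inl ++ (w ++ q.map Sum.inl)) := by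
  rw [isWord_append, isWord_append, isWord_map_inl, isWord_map_inl]
  refine ⟨hp, ⟨hw, hq, ?_⟩, ?_⟩
  · intro x hx y hy
    have := h₂ x hx
    obtain ⟨z, -, rfl⟩ : ∃ z, q.head? = some z ∧ Sum.inl z = y := by simpa using hy
    obtain ⟨u, rfl⟩ := Sum.isRight_iff.1 this
    simp [index]
  · intro x hx y hy
    rw [List.head?_append_of_ne_nil _ hw0] at hy
    have := h₁ y hy
    obtain ⟨z, -, rfl⟩ : ∃ z, p.getLast? = some z ∧ Sum.inl z = x := by simpa using hx
    obtain ⟨u, rfl⟩ := Sum.isRight_iff.1 this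
    simp [index]

end

/-- Every word is a word over `A`, or has exactly one letter from `F`, or has a first and a last
letter from `F`. -/
theorem word_cases (w : List ((I × A) ⊕ (J × F))) :
    (∃ p : List (I × A), w = p.map Sum.inl) ∨
      (∃ (p : List (I × A)) (y : J × F) (q : List (I × A)),
        w = p.map Sum.inl ++ .inr y :: q.map Sum.inl) ∨
      ∃ (p : List (I × A)) (y : J × F) (v : List ((I × A) ⊕ (J × F))) (z : J × F)
        (q : List (I × A)), w = p.map Sum.inl ++ .inr y :: (v ++ .inr z :: q.map Sum.inl) := by
  induction w with
  | nil => exact .inl ⟨[], rfl⟩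
  | cons x w ih =>
    rcases x with x | x <;> rcases ih with ⟨p, rfl⟩ | ⟨p, y, q, rfl⟩ | ⟨p, y, v, z, q, rfl⟩
    · exact .inl ⟨x :: p, rfl⟩
    · exact .inr (.inl ⟨x :: p, y, q, rfl⟩)
    · exact .inr (.inr ⟨x :: p, y, v, z, q, rfl⟩)
    · exact .inr (.inl ⟨[], x, p, rfl⟩)
    · exact .inr (.inr ⟨[], x, p.map Sum.inl, y, q, by simp⟩)
    · exact .inr (.inr ⟨[], x, p.map Sum.inl ++ .inr y :: v, z, q, by simp⟩)

/-! ### Freeness -/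

open Classical in
/-- The pairing of two words, letter by letter: the product of the numbers `φ (x y)` over the pairs
of letters if the words have the same sequence of indices, and `0` otherwise. -/
noncomputable def pairing (φ : A →ₗ[ℂ] ℂ) : List (I × A) → List (I × A) → ℂ
  | [], [] => 1
  | x :: p, y :: q => if x.1 = y.1 then φ (x.2 * y.2) * pairing φ p q else 0
  | [], _ :: _ => 0
  | _ :: _, [] => 0

/-- Free independence in terms of lists. -/
def FreeWords (φ : A →ₗ[ℂ] ℂ) (𝒜 : I → Subalgebra ℂ A) : Prop :=
  ∀ p : List (I × A), IsReduced φ 𝒜 p → p ≠ [] → φ (p.map Prod.snd).prod = 0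

theorem free_iff_freeWords (φ : A →ₗ[ℂ] ℂ) (𝒜 : I → Subalgebra ℂ A) :
    Free φ 𝒜 ↔ FreeWords φ 𝒜 := by
  constructor
  · intro h p hp h0
    have := h p.length (fun k => p[k].1) (fun k => p[k].2) (List.length_pos_iff.2 h0)
      (fun k l hkl => by
        have := List.isChain_iff_getElem.1 hp.1 k (by omega)
        simpa [hkl] using this)
      (fun k => hp.2 _ (List.getElem_mem _))
    convert this
    exact List.ext_getElem (by simp) (by simp)
  · intro h n i a hn hi ha
    have := h (List.ofFn fun k => (i k, a k))
      ⟨List.isChain_iff_getElem.2 fun k hk => by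
        simpa using hi _ _ rfl, by simpa [List.mem_ofFn] using ha⟩
      (by simpa using hn.ne')
    simpa [List.map_ofFn, Function.comp_def] using this

/-- The value of `φ` on a product of two centred words in free subalgebras: letters which meet in
the middle and belong to the same subalgebra are contracted, and the word vanishes as soon as two
letters which meet belong to different subalgebras. -/
theorem FreeWords.apply_reverse_mul {φ : A →ₗ[ℂ] ℂ} {𝒜 : I → Subalgebra ℂ A} (hφ : φ 1 = 1)
    (h : FreeWords φ 𝒜) {p q : List (I × A)} (hp : IsReduced φ 𝒜 p) (hq : IsReduced φ 𝒜 q) :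
    φ ((p.reverse.map Prod.snd).prod * (q.map Prod.snd).prod) = pairing φ p q := by
  induction p generalizing q with
  | nil =>
    cases q with
    | nil => simp [pairing, hφ]
    | cons y q => simpa [pairing] using h _ hq (by simp)
  | cons x p ih =>
    cases q with
    | nil => simpa [pairing] using h _ (isReduced_reverse.2 hp) (by simp)
    | cons y q =>
      have hp' := isReduced_cons.1 hp
      have hq' := isReduced_cons.1 hq
      by_cases hxy : x.1 = y.1
      · rw [pairing, if_pos hxy, ← ih hp'.2.2 hq'.2.2]
        -- The product `x y` is its expectation plus a centred element of the same subalgebra.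
        have key := h (p.reverse ++ (x.1, x.2 * y.2 - algebraMap ℂ A (φ (x.2 * y.2))) :: q) (by
          rw [isReduced_append, isReduced_cons, isReduced_reverse]
          refine ⟨hp'.2.2, ⟨⟨?_, ?_⟩, ?_, hq'.2.2⟩, ?_⟩
          · exact Subalgebra.sub_mem _ (Subalgebra.mul_mem _ hp'.1.1 (hxy ▸ hq'.1.1))
              (Subalgebra.algebraMap_mem _ _)
          · simp [Algebra.algebraMap_eq_smul_one, hφ]
          · simpa [hxy] using hq'.2.1
          · intro u hu v hv
            obtain rfl : _ = v := by simpa using hv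
            rw [List.getLast?_reverse] at hu
            exact (hp'.2.1 u hu).symm) (by simp)
        have e : ((x :: p).reverse.map Prod.snd).prod * ((y :: q).map Prod.snd).prod =
            ((p.reverse ++ (x.1, x.2 * y.2 - algebraMap ℂ A (φ (x.2 * y.2))) :: q).map
              Prod.snd).prod +
            φ (x.2 * y.2) • ((p.reverse.map Prod.snd).prod * (q.map Prod.snd).prod) := by
          simp [sub_mul, mul_sub, mul_assoc, Algebra.algebraMap_eq_smul_one]
        rw [e, map_add, key, map_smul, zero_add, smul_eq_mul]
      · rw [pairing, if_neg hxy]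
        have := h ((x :: p).reverse ++ y :: q) (by
          rw [isReduced_append, isReduced_reverse]
          refine ⟨hp, hq, ?_⟩
          intro u hu v hv
          obtain rfl : _ = u := by simpa using hu
          obtain rfl : _ = v := by simpa using hv
          exact hxy) (by simp)
        simpa [mul_assoc] using this

/-- The algebra generated by the `𝒜 i` is spanned by centred words. -/
theorem iSup_le_span_reduced {φ : A →ₗ[ℂ] ℂ} (hφ : φ 1 = 1) (𝒜 : I → Subalgebra ℂ A) {a : A}
    (ha : a ∈ ⨆ i, 𝒜 i) :
    a ∈ Submodule.span ℂ ((fun p : List (I × A) => (p.map Prod.snd).prod) ''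
      {p | IsReduced φ 𝒜 p}) := by
  set W := Submodule.span ℂ ((fun p : List (I × A) => (p.map Prod.snd).prod) ''
      {p | IsReduced φ 𝒜 p}) with hW
  have mem {p : List (I × A)} (hp : IsReduced φ 𝒜 p) : (p.map Prod.snd).prod ∈ W :=
    Submodule.subset_span ⟨p, hp, rfl⟩
  let T : Subalgebra ℂ A :=
    { carrier := {x | ∀ w ∈ W, x * w ∈ W}
      mul_mem' := fun {x y} hx hy w hw => by rw [mul_assoc]; exact hx _ (hy _ hw)
      add_mem' := fun {x y} hx hy w hw => by
        rw [add_mul]; exact W.add_mem (hx _ hw) (hy _ hw)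
      algebraMap_mem' := fun c w hw => by
        rw [← Algebra.smul_def]; exact W.smul_mem c hw }
  have hT : ⨆ i, 𝒜 i ≤ T := iSup_le fun i x hx w hw => by
    -- A letter of `𝒜 i` in front of a word which does not begin in `𝒜 i`.
    have step : ∀ z ∈ 𝒜 i, ∀ q : List (I × A), IsReduced φ 𝒜 q → (∀ y ∈ q.head?, i ≠ y.1) →
        z * (q.map Prod.snd).prod ∈ W := by
      intro z hz q hq h
      have h1 : IsReduced φ 𝒜 ((i, z - algebraMap ℂ A (φ z)) :: q) :=
        isReduced_cons.2 ⟨⟨Subalgebra.sub_mem _ hz (Subalgebra.algebraMap_mem _ _),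
          by simp [Algebra.algebraMap_eq_smul_one, hφ]⟩, h, hq⟩
      have := W.add_mem (mem h1) (W.smul_mem (φ z) (mem hq))
      simpa [sub_mul, Algebra.algebraMap_eq_smul_one] using this
    induction hw using Submodule.span_induction with
    | mem w hw =>
      obtain ⟨p, hp, rfl⟩ := hw
      by_cases h : ∀ y ∈ p.head?, i ≠ y.1
      · exact step x hx p hp h
      · push Not at h
        obtain ⟨y, hy, rfl⟩ := h
        obtain ⟨q, rfl⟩ := List.head?_eq_some_iff.1 hy
        have hq := isReduced_cons.1 hp
        simpa [mul_assoc] using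
          step (x * y.2) (Subalgebra.mul_mem _ hx hq.1.1) q hq.2.2 hq.2.1
    | zero => simp
    | add u v _ _ hu hv => rw [mul_add]; exact W.add_mem hu hv
    | smul c u _ hu => rw [mul_smul_comm]; exact W.smul_mem c hu
  have := hT ha 1 (by simpa using mem (isReduced_nil φ 𝒜))
  simpa using this

theorem prod_mem_iSup {φ : A →ₗ[ℂ] ℂ} {𝒜 : I → Subalgebra ℂ A} {p : List (I × A)}
    (hp : IsReduced φ 𝒜 p) : (p.map Prod.snd).prod ∈ ⨆ i, 𝒜 i :=
  Subalgebra.list_prod_mem _ fun a ha => by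
    obtain ⟨x, hx, rfl⟩ := List.mem_map.1 ha
    exact (le_iSup 𝒜 x.1 : _) (hp.2 x hx).1

/-! ### Mixed words and their comparison words -/

variable (A) in
/-- An element `f` of `F`, paired with itself. -/
def twinPert : F →ₗ[ℂ] Assoc A F × Assoc A F := (ofPert A).prod (ofPert A)

variable (F) in
/-- An element `a` of `A`, paired with the scalar `φ a`. -/
def twinMain (φ : A →ₗ[ℂ] ℂ) : A →ₗ[ℂ] Assoc A F × Assoc A F :=
  (ofMain F).toLinearMap.prod ((LinearMap.toSpanSingleton ℂ (Assoc A F) 1).comp φ)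

@[simp] theorem twinPert_apply (f : F) : twinPert A f = (ofPert A f, ofPert A f) := rfl

@[simp] theorem twinMain_apply (φ : A →ₗ[ℂ] ℂ) (a : A) :
    twinMain F φ a = (ofMain F a, φ a • 1) := rfl

theorem twinPert_mul (f g : F) : twinPert A (f * g) = twinPert A f * twinPert A g := by
  simp [ofPert_mul]

/-- The word `f a₁ f₁ ⋯ aₘ fₘ`, where `L` lists the pairs `(aₖ, fₖ)`, together with the word in
which each `aₖ` is replaced by the scalar `φ aₖ`. -/
def midWord (φ : A →ₗ[ℂ] ℂ) (f : F) : List (A × F) → Assoc A F × Assoc A F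
  | [] => twinPert A f
  | x :: L => twinPert A f * (twinMain F φ x.1 * midWord φ x.2 L)

/-- The value of a centred word, together with the value of the word in which each letter from `A`
is replaced by its expectation, which is `0`. -/
def twinEval (w : List ((I × A) ⊕ (J × F))) : Assoc A F × Assoc A F :=
  (w.map (Sum.elim (fun x => (ofMain F x.2, 0)) fun y => twinPert A y.2)).prod

@[simp] theorem twinEval_nil : twinEval ([] : List ((I × A) ⊕ (J × F))) = 1 := rfl

@[simp] theorem twinEval_inl_cons (x : I × A) (w : List ((I × A) ⊕ (J × F))) :
    twinEval (.inl x :: w) = (ofMain F x.2, 0) * twinEval w := by simp [twinEval]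

@[simp] theorem twinEval_inr_cons (y : J × F) (w : List ((I × A) ⊕ (J × F))) :
    twinEval (.inr y :: w) = twinPert A y.2 * twinEval w := by simp [twinEval]

@[simp] theorem twinEval_append (v w : List ((I × A) ⊕ (J × F))) :
    twinEval (v ++ w) = twinEval v * twinEval w := by simp [twinEval]

theorem twinEval_fst (w : List ((I × A) ⊕ (J × F))) : (twinEval w).1 = eval w := by
  induction w with
  | nil => rfl
  | cons x w ih => cases x <;> simp [letter, ih]

theorem twinEval_snd_of_forall {w : List ((I × A) ⊕ (J × F))} (h : ∀ x ∈ w, x.isRight) :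
    (twinEval w).2 = eval w := by
  induction w with
  | nil => rfl
  | cons x w ih =>
    rw [List.forall_mem_cons] at h
    obtain ⟨y, rfl⟩ := Sum.isRight_iff.1 h.1
    simp [letter, ih h.2]

theorem twinEval_snd_of_exists {w : List ((I × A) ⊕ (J × F))} (h : ¬ ∀ x ∈ w, x.isRight) :
    (twinEval w).2 = 0 := by
  induction w with
  | nil => simp at h
  | cons x w ih =>
    cases x with
    | inl x => simp
    | inr y => simp [ih (by simpa using h)]

variable {φ : A →ₗ[ℂ] ℂ} {𝒜 : I → Subalgebra ℂ A} {ℱ : J → NonUnitalSubalgebra ℂ F}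

theorem twinMain_prod (hφ : φ 1 = 1) (h : FreeWords φ 𝒜) {p : List (I × A)}
    (hp : IsReduced φ 𝒜 p) :
    twinMain F φ (p.map Prod.snd).prod =
      twinEval (p.map (Sum.inl : _ → (I × A) ⊕ (J × F))) := by
  cases p with
  | nil => simp [hφ]
  | cons x p =>
    have h1 := h _ hp (by simp)
    refine Prod.ext ?_ ?_
    · rw [twinEval_fst, eval_map_inl]; rfl
    · rw [twinMain_apply, h1, zero_smul, List.map_cons (f := Sum.inl), twinEval_inl_cons,
        Prod.snd_mul, zero_mul]

/-- A centred alternating word which ends with a letter from `F`. -/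
def EndsInPert (φ : A →ₗ[ℂ] ℂ) (𝒜 : I → Subalgebra ℂ A) (ℱ : J → NonUnitalSubalgebra ℂ F)
    (w : List ((I × A) ⊕ (J × F))) : Prop :=
  IsWord φ 𝒜 ℱ w ∧ w ≠ [] ∧ ∀ x ∈ w.getLast?, x.isRight

/-- A centred alternating word whose first and last letters are from `F`. -/
def IsCore (φ : A →ₗ[ℂ] ℂ) (𝒜 : I → Subalgebra ℂ A) (ℱ : J → NonUnitalSubalgebra ℂ F)
    (w : List ((I × A) ⊕ (J × F))) : Prop :=
  EndsInPert φ 𝒜 ℱ w ∧ ∀ x ∈ w.head?, x.isRight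

theorem endsInPert_map_inl_append {p : List (I × A)} {w : List ((I × A) ⊕ (J × F))}
    (hp : IsReduced φ 𝒜 p) (hw : IsCore φ 𝒜 ℱ w) :
    EndsInPert φ 𝒜 ℱ (p.map Sum.inl ++ w) := by
  refine ⟨?_, by simp [hw.1.2.1], ?_⟩
  · simpa using isWord_sandwich hp (isReduced_nil φ 𝒜) hw.1.1 hw.1.2.1 hw.2 hw.1.2.2
  · rw [List.getLast?_append_of_ne_nil _ hw.1.2.1]
    exact hw.1.2.2

theorem IsCore.cases {w : List ((I × A) ⊕ (J × F))} (hw : IsCore φ 𝒜 ℱ w) :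
    (∃ y, w = [.inr y]) ∨ ∃ y v z, w = .inr y :: (v ++ [.inr z]) := by
  obtain ⟨⟨-, h0, hl⟩, hh⟩ := hw
  cases w with
  | nil => exact absurd rfl h0
  | cons x u =>
    obtain ⟨y, rfl⟩ := Sum.isRight_iff.1 (hh x (by simp))
    rcases List.eq_nil_or_concat u with rfl | ⟨v, z, rfl⟩
    · exact .inl ⟨y, rfl⟩
    · obtain ⟨z, rfl⟩ := Sum.isRight_iff.1 (hl z (by simp [List.getLast?_cons]))
      exact .inr ⟨y, v, z, by simp⟩

/-- A letter from `F` in front of a word which ends in `F`: adjacent letters from the same `ℱ j` are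
merged. -/
theorem exists_core_twinPert_mul {j : J} {f : F} (hf : f ∈ ℱ j) {w : List ((I × A) ⊕ (J × F))}
    (hw : EndsInPert φ 𝒜 ℱ w) :
    ∃ v, IsCore φ 𝒜 ℱ v ∧ twinEval v = twinPert A f * twinEval w := by
  obtain ⟨hw, h0, hl⟩ := hw
  by_cases h : ∀ x ∈ w.head?, index (.inr (j, f) : (I × A) ⊕ (J × F)) ≠ index x
  · refine ⟨.inr (j, f) :: w, ⟨⟨isWord_cons.2 ⟨hf, h, hw⟩, by simp, ?_⟩, by simp⟩, by simp⟩
    cases w with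
    | nil => exact absurd rfl h0
    | cons x w => simpa using hl
  · push Not at h
    obtain ⟨x, hx, hj⟩ := h
    obtain ⟨u, rfl⟩ := List.head?_eq_some_iff.1 hx
    cases x with
    | inl x => simp [index] at hj
    | inr y =>
      obtain ⟨j', g⟩ := y
      obtain rfl : j = j' := by simpa [index] using hj
      have hu := isWord_cons.1 hw
      refine ⟨.inr (j, f * g) :: u, ⟨⟨isWord_cons.2 ⟨(ℱ j).mul_mem hf hu.1, hu.2.1, hu.2.2⟩,
        by simp, ?_⟩, by simp⟩, ?_⟩
      · cases u with
        | nil => simp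
        | cons x w => simpa using hl
      · rw [twinEval_inr_cons, twinEval_inr_cons, twinPert_mul, mul_assoc]

/-- Mixed words with entries in the generated algebras are combinations of centred alternating
words, simultaneously with their comparison words. -/
theorem midWord_mem_span (hφ : φ 1 = 1) (h : FreeWords φ 𝒜) {f : F} {L : List (A × F)}
    (hf : f ∈ ⨆ j, ℱ j) (hL : ∀ x ∈ L, x.1 ∈ ⨆ i, 𝒜 i ∧ x.2 ∈ ⨆ j, ℱ j) :
    midWord φ f L ∈ Submodule.span ℂ (twinEval '' {w | IsCore φ 𝒜 ℱ w}) := by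
  set V := Submodule.span ℂ (twinEval '' {w | IsCore φ 𝒜 ℱ w}) with hV
  set V' := Submodule.span ℂ (twinEval '' {w | EndsInPert φ 𝒜 ℱ w}) with hV'
  have hVV' : V ≤ V' := Submodule.span_mono (Set.image_mono fun w hw => hw.1)
  have hmain : ∀ a ∈ ⨆ i, 𝒜 i, ∀ v ∈ V, twinMain F φ a * v ∈ V' := by
    intro a ha v hv
    induction hv using Submodule.span_induction with
    | mem v hv =>
      obtain ⟨w, hw, rfl⟩ := hv
      replace ha := iSup_le_span_reduced hφ 𝒜 ha
      induction ha using Submodule.span_induction with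
      | mem a ha =>
        obtain ⟨p, hp, rfl⟩ := ha
        refine Submodule.subset_span ⟨p.map Sum.inl ++ w, endsInPert_map_inl_append hp hw, ?_⟩
        rw [twinEval_append, twinMain_prod hφ h hp]
      | zero => simp only [map_zero, zero_mul, zero_mem]
      | add a b _ _ ha hb => rw [map_add, add_mul]; exact V'.add_mem ha hb
      | smul c a _ ha => rw [map_smul, smul_mul_assoc]; exact V'.smul_mem c ha
    | zero => simp only [mul_zero, zero_mem]
    | add u v _ _ hu hv => rw [mul_add]; exact V'.add_mem hu hv
    | smul c u _ hu => rw [mul_smul_comm]; exact V'.smul_mem c hu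
  let T : NonUnitalSubalgebra ℂ F :=
    { carrier := {g | twinPert A g ∈ V ∧ ∀ v ∈ V', twinPert A g * v ∈ V}
      add_mem' := fun {f g} hf hg => by
        refine ⟨?_, fun v hv => ?_⟩
        · rw [map_add]; exact V.add_mem hf.1 hg.1
        · rw [map_add, add_mul]; exact V.add_mem (hf.2 v hv) (hg.2 v hv)
      zero_mem' := by
        refine ⟨?_, fun v hv => ?_⟩
        · rw [map_zero]; exact V.zero_mem
        · rw [map_zero, zero_mul]; exact V.zero_mem
      mul_mem' := fun {f g} hf hg => by
        refine ⟨?_, fun v hv => ?_⟩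
        · rw [twinPert_mul]; exact hf.2 _ (hVV' hg.1)
        · rw [twinPert_mul, mul_assoc]; exact hf.2 _ (hVV' (hg.2 v hv))
      smul_mem' := fun c f hf => by
        refine ⟨?_, fun v hv => ?_⟩
        · rw [map_smul]; exact V.smul_mem c hf.1
        · rw [map_smul, smul_mul_assoc]; exact V.smul_mem c (hf.2 v hv) }
  have hT : ⨆ j, ℱ j ≤ T := iSup_le fun j g hg => by
    refine ⟨Submodule.subset_span ⟨[.inr (j, g)], ⟨⟨?_, by simp, by simp⟩, by simp⟩, by simp⟩,
      fun v hv => ?_⟩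
    · exact ⟨List.isChain_singleton _, by simpa [IsLetter] using hg⟩
    · induction hv using Submodule.span_induction with
      | mem v hv =>
        obtain ⟨w, hw, rfl⟩ := hv
        obtain ⟨u, hu, e⟩ := exists_core_twinPert_mul hg hw
        exact Submodule.subset_span ⟨u, hu, e⟩
      | zero => simp only [mul_zero, zero_mem]
      | add u v _ _ hu hv => rw [mul_add]; exact V.add_mem hu hv
      | smul c u _ hu => rw [mul_smul_comm]; exact V.smul_mem c hu
  induction L generalizing f with
  | nil => exact (hT hf).1
  | cons x L ih =>
    rw [List.forall_mem_cons] at hL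
    exact (hT hf).2 _ (hmain _ hL.1.1 _ (ih hL.1.2 hL.2))

/-- A centred alternating word which begins and ends in `F` is a mixed word, simultaneously with the
comparison words. -/
theorem IsCore.exists_midWord (hφ : φ 1 = 1) (h : FreeWords φ 𝒜) {w : List ((I × A) ⊕ (J × F))}
    (hw : IsCore φ 𝒜 ℱ w) :
    ∃ (f : F) (L : List (A × F)), f ∈ ⨆ j, ℱ j ∧ (∀ x ∈ L, x.1 ∈ ⨆ i, 𝒜 i ∧ x.2 ∈ ⨆ j, ℱ j) ∧
      twinEval w = midWord φ f L := by
  have key : ∀ w : List ((I × A) ⊕ (J × F)), EndsInPert φ 𝒜 ℱ w →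
      ∃ (p : List (I × A)) (v : List ((I × A) ⊕ (J × F))) (f : F) (L : List (A × F)),
        w = p.map Sum.inl ++ v ∧ f ∈ ⨆ j, ℱ j ∧
        (∀ x ∈ L, x.1 ∈ ⨆ i, 𝒜 i ∧ x.2 ∈ ⨆ j, ℱ j) ∧ twinEval v = midWord φ f L := by
    intro w
    induction w with
    | nil => exact fun hw => absurd rfl hw.2.1
    | cons x u ih =>
      rintro ⟨hw, -, hl⟩
      have hw' := isWord_cons.1 hw
      cases u with
      | nil =>
        obtain ⟨y, rfl⟩ := Sum.isRight_iff.1 (hl x (by simp))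
        exact ⟨[], _, y.2, [], rfl, (le_iSup ℱ y.1 : _) hw'.1, by simp, by simp [midWord]⟩
      | cons x' u =>
        obtain ⟨p, v, f, L, e, hf, hL, hv⟩ := ih ⟨hw'.2.2, by simp, by simpa using hl⟩
        rw [e] at hw' ⊢
        cases x with
        | inl x => exact ⟨x :: p, v, f, L, rfl, hf, hL, hv⟩
        | inr y =>
          have hp : IsReduced φ 𝒜 p := isWord_map_inl.1 (isWord_append.1 hw'.2.2).1
          refine ⟨[], _, y.2, ((p.map Prod.snd).prod, f) :: L, rfl,
            (le_iSup ℱ y.1 : _) hw'.1, ?_, ?_⟩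
          · rw [List.forall_mem_cons]
            exact ⟨⟨prod_mem_iSup hp, hf⟩, hL⟩
          · rw [twinEval_inr_cons, twinEval_append, midWord, hv, ← twinMain_prod hφ h hp]
  obtain ⟨p, v, f, L, e, hf, hL, hv⟩ := key w hw.1
  cases p with
  | nil => exact ⟨f, L, hf, hL, by simpa [e] using hv⟩
  | cons x p => simpa [e] using hw.2

/-! ### Cyclic-antimonotone independence -/

theorem ofPert_wordProd_op_smul (φ : A →ₗ[ℂ] ℂ) {m : ℕ} (a : Fin (m + 1) → A)
    (f : Fin (m + 1) → F) :
    ofPert A (wordProd fun k => op (a k) • f k) =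
      (midWord φ (f 0) (List.ofFn fun k : Fin m => (a k.castSucc, f k.succ))).1 *
        ofMain F (a (Fin.last m)) := by
  induction m with
  | zero => simp [wordProd, midWord, ofPert_mul_ofMain]
  | succ m ih =>
    rw [wordProd, ofPert_mul, ih (fun k => a k.succ) fun k => f k.succ, List.ofFn_succ, midWord]
    simp [mul_assoc, ← ofPert_mul_ofMain]

theorem midWord_snd (φ : A →ₗ[ℂ] ℂ) {m : ℕ} (a : Fin m → A) (f : Fin (m + 1) → F) :
    (midWord φ (f 0) (List.ofFn fun k : Fin m => (a k, f k.succ))).2 =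
      (∏ k, φ (a k)) • ofPert A (wordProd f) := by
  induction m with
  | zero => simp [wordProd, midWord]
  | succ m ih =>
    rw [wordProd, ofPert_mul, List.ofFn_succ, midWord, Prod.snd_mul, Prod.snd_mul,
      ih (fun k => a k.succ) fun k => f k.succ, Fin.prod_univ_succ]
    simp [mul_smul, smul_comm (φ (a 0))]

/-- Cyclic-antimonotone independence in terms of mixed words and their comparison words. -/
theorem cyclicAntimonotone_iff (φ : A →ₗ[ℂ] ℂ) (Φ : F →ₗ[ℂ] ℂ) (A₁ : Subalgebra ℂ A)
    (F₁ : NonUnitalSubalgebra ℂ F) :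
    CyclicAntimonotone φ Φ A₁ F₁ ↔ ∀ a ∈ A₁, ∀ b ∈ A₁, ∀ f ∈ F₁, ∀ L : List (A × F),
      (∀ x ∈ L, x.1 ∈ A₁ ∧ x.2 ∈ F₁) →
        phi' A Φ (ofMain F a * (midWord φ f L).1 * ofMain F b) =
          φ (a * b) * phi' A Φ (midWord φ f L).2 := by
  have e : ∀ (m : ℕ) (a : Fin (m + 2) → A) (f : Fin (m + 1) → F),
      (Φ (mixedWord a f) = φ (a 0 * a (Fin.last (m + 1))) * (∏ k : Fin m, φ (a k.succ.castSucc)) *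
        Φ (wordProd f)) ↔
      phi' A Φ (ofMain F (a 0) * (midWord φ (f 0)
        (List.ofFn fun k : Fin m => (a k.succ.castSucc, f k.succ))).1 *
          ofMain F (a (Fin.last (m + 1)))) =
        φ (a 0 * a (Fin.last (m + 1))) * phi' A Φ (midWord φ (f 0)
          (List.ofFn fun k : Fin m => (a k.succ.castSucc, f k.succ))).2 := by
    intro m a f
    have h1 := ofPert_wordProd_op_smul φ (fun k => a k.succ) f
    have h2 := midWord_snd φ (fun k : Fin m => a k.succ.castSucc) f
    simp only [Fin.succ_last, ← Fin.castSucc_succ] at h1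
    rw [h2, mul_assoc (ofMain F (a 0)), ← h1, ofMain_mul_ofPert, LinearMap.map_smul (phi' A Φ),
      phi'_apply, phi'_apply, pert_ofPert, pert_ofPert, smul_eq_mul, mul_assoc]
    rfl
  constructor
  · intro h a ha b hb f hf L hL
    have := (e L.length (Fin.cons a (Fin.snoc (fun k => L[k].1) b))
      (Fin.cons f fun k => L[k].2)).1 (h _ _ _ ?_ ?_)
    · have hl : (List.ofFn fun k : Fin L.length => (L[k].1, L[k].2)) = L :=
        List.ext_getElem (by simp) (by simp)
      simpa only [Fin.cons_zero, ← Fin.succ_last, Fin.cons_succ, Fin.snoc_last, Fin.castSucc_succ,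
        Fin.snoc_castSucc, hl] using this
    · intro k
      refine Fin.cases ha (fun k => ?_) k
      rw [Fin.cons_succ]
      refine Fin.lastCases ?_ (fun k => ?_) k
      · simpa using hb
      · simpa using (hL _ (List.getElem_mem k.2)).1
    · intro k
      refine Fin.cases hf (fun k => ?_) k
      simpa using (hL _ (List.getElem_mem k.2)).2
  · intro h m a f ha hf
    refine (e m a f).2 (h _ (ha _) _ (ha _) _ (hf _) _ ?_)
    intro x hx
    obtain ⟨k, rfl⟩ := List.mem_ofFn.1 hx
    exact ⟨ha _, hf _⟩

/-- Trivial independence in terms of words which have at least two letters, all from `F`. -/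
theorem triviallyIndependent_iff (φ : A →ₗ[ℂ] ℂ) (Φ : F →ₗ[ℂ] ℂ) (𝒜 : I → Subalgebra ℂ A)
    (ℱ : J → NonUnitalSubalgebra ℂ F) :
    TriviallyIndependent Φ ℱ ↔ ∀ (y z : J × F) (w : List ((I × A) ⊕ (J × F))),
      IsWord φ 𝒜 ℱ (.inr y :: (w ++ [.inr z])) → (∀ x ∈ w, x.isRight) →
        phi' A Φ (eval (.inr y :: (w ++ [.inr z]))) = 0 := by
  have e : ∀ (n : ℕ) (f : Fin (n + 1) → F) (j : Fin (n + 1) → J),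
      eval (List.ofFn fun k => (.inr (j k, f k) : (I × A) ⊕ (J × F))) = ofPert A (wordProd f) := by
    intro n
    induction n with
    | zero => intro f j; simp [wordProd, letter]
    | succ n ih =>
      intro f j
      rw [List.ofFn_succ, eval_cons, ih (fun k => f k.succ) fun k => j k.succ, wordProd, ofPert_mul]
      rfl
  constructor
  · intro h y z w hw hr
    generalize hu : Sum.inr y :: (w ++ [Sum.inr z]) = u at hw ⊢
    have hur : ∀ x ∈ u, x.isRight := by
      subst hu
      simpa [or_imp, forall_and] using hr
    have hlen : u.length = w.length + 2 := by subst hu; simp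
    have hc : ∀ k : Fin (w.length + 2), ∃ v : J × F, u[(k : ℕ)]'(by omega) = .inr v := fun k =>
      Sum.isRight_iff.1 (hur _ (List.getElem_mem _))
    choose v hv using hc
    have huv : u = List.ofFn fun k => (.inr ((v k).1, (v k).2) : (I × A) ⊕ (J × F)) :=
      List.ext_getElem (by simp [hlen]) fun k h1 h2 => by
        rw [List.getElem_ofFn]
        exact hv ⟨k, by omega⟩
    rw [huv, e, phi'_apply, pert_ofPert]
    refine h _ (fun k => (v k).1) _ (fun k l hkl => ?_) fun k => ?_
    · have := List.isChain_iff_getElem.1 hw.1 k (by omega)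
      have h2 := hv l
      simp only [← hkl] at h2
      rw [hv k, h2] at this
      simpa [index] using this
    · have := hw.2 _ (List.getElem_mem (l := u) (n := k) (by omega))
      rwa [hv k] at this
  · intro h n j f hj hf
    have hl : (List.ofFn fun k => (.inr (j k, f k) : (I × A) ⊕ (J × F))) =
        .inr (j 0, f 0) :: ((List.ofFn fun k : Fin n =>
          (.inr (j k.succ.castSucc, f k.succ.castSucc) : (I × A) ⊕ (J × F))) ++
            [.inr (j (Fin.last _), f (Fin.last _))]) := by
      rw [List.ofFn_succ, List.ofFn_succ', List.concat_eq_append]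
      simp [Fin.castSucc_succ, Fin.succ_last]
    have hw : IsWord φ 𝒜 ℱ (List.ofFn fun k => (.inr (j k, f k) : (I × A) ⊕ (J × F))) := by
      refine ⟨List.isChain_iff_getElem.2 fun k hk => ?_, fun x hx => ?_⟩
      · simp only [List.getElem_ofFn]
        simpa [index] using hj ⟨k, by simp at hk; omega⟩ ⟨k + 1, by simpa using hk⟩ rfl
      · obtain ⟨k, rfl⟩ := List.mem_ofFn.1 hx
        exact hf k
    have := h (j 0, f 0) (j (Fin.last _), f (Fin.last _)) _ (hl ▸ hw) ?_
    · rw [← hl, e] at this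
      exact this
    · intro x hx
      obtain ⟨k, rfl⟩ := List.mem_ofFn.1 hx
      rfl

/-! ### The rule for centred words -/

/-- The values of `φ` and `φ'` on centred alternating words, sorted by the number of letters
from `F`. -/
structure WordRule (φ : A →ₗ[ℂ] ℂ) (Φ : F →ₗ[ℂ] ℂ) (𝒜 : I → Subalgebra ℂ A)
    (ℱ : J → NonUnitalSubalgebra ℂ F) : Prop where
  free : FreeWords φ 𝒜
  single : ∀ (p q : List (I × A)) (y : J × F),
    IsWord φ 𝒜 ℱ (p.map Sum.inl ++ .inr y :: q.map Sum.inl) →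
      phi' A Φ (eval (p.map Sum.inl ++ .inr y :: q.map Sum.inl)) = pairing φ p.reverse q * Φ y.2
  multi : ∀ (p q : List (I × A)) (y z : J × F) (w : List ((I × A) ⊕ (J × F))),
    IsWord φ 𝒜 ℱ (p.map Sum.inl ++ .inr y :: (w ++ .inr z :: q.map Sum.inl)) →
      phi' A Φ (eval (p.map Sum.inl ++ .inr y :: (w ++ .inr z :: q.map Sum.inl))) = 0

/-- Under the rule for centred words, `φ'` sees a core between two elements of `A` only through its
comparison word. -/
theorem WordRule.core {Φ : F →ₗ[ℂ] ℂ} (hφ : φ 1 = 1) (h : WordRule φ Φ 𝒜 ℱ) {a b : A}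
    (ha : a ∈ ⨆ i, 𝒜 i) (hb : b ∈ ⨆ i, 𝒜 i) {w : List ((I × A) ⊕ (J × F))}
    (hw : IsCore φ 𝒜 ℱ w) :
    phi' A Φ (ofMain F a * eval w * ofMain F b) = φ (a * b) * phi' A Φ (twinEval w).2 := by
  replace ha := iSup_le_span_reduced hφ 𝒜 ha
  replace hb := iSup_le_span_reduced hφ 𝒜 hb
  induction ha using Submodule.span_induction with
  | zero => simp only [map_zero, zero_mul]
  | add a b _ _ ha hb => simp only [map_add, add_mul, ha, hb]
  | smul c a _ ha => simp only [map_smul, smul_mul_assoc, ha, smul_eq_mul, mul_assoc c]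
  | mem a ha =>
    obtain ⟨p, hp, rfl⟩ := ha
    induction hb using Submodule.span_induction with
    | zero => simp only [map_zero, mul_zero, zero_mul]
    | add a b _ _ ha hb => simp only [map_add, mul_add, add_mul, ha, hb]
    | smul c a _ ha => simp only [map_smul, mul_smul_comm, ha, smul_eq_mul, mul_assoc c]
    | mem b hb =>
      obtain ⟨q, hq, rfl⟩ := hb
      have hpq := isWord_sandwich hp hq hw.1.1 hw.1.2.1 hw.2 hw.1.2.2
      have e : ofMain F (p.map Prod.snd).prod * eval w * ofMain F (q.map Prod.snd).prod =
          eval (p.map Sum.inl ++ (w ++ q.map Sum.inl)) := by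
        rw [eval_append, eval_append, eval_map_inl, eval_map_inl, mul_assoc]
      dsimp only
      rw [e]
      have hw0 := hw.1.1
      rcases hw.cases with ⟨y, rfl⟩ | ⟨y, v, z, rfl⟩
      · have := h.free.apply_reverse_mul hφ (isReduced_reverse.2 hp) hq
        rw [List.reverse_reverse] at this
        rw [this]
        simpa using h.single p q y (by simpa using hpq)
      · have h1 := h.multi p q y z v (by simpa using hpq)
        have h2 : phi' A Φ (twinEval (Sum.inr y :: (v ++ [Sum.inr z]))).2 = 0 := by
          by_cases hr : ∀ x ∈ Sum.inr y :: (v ++ [Sum.inr z]), x.isRight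
          · rw [twinEval_snd_of_forall hr]
            simpa using h.multi [] [] y z v (by simpa using hw0)
          · rw [twinEval_snd_of_exists hr, map_zero]
        rw [h2, mul_zero, ← h1]
        simp

/-- Both directions pass between mixed words over the generated algebras and centred alternating
words. -/
theorem bPrimeFree_iff_wordRule (hφ : φ 1 = 1) (Φ : F →ₗ[ℂ] ℂ) :
    BPrimeFree φ Φ 𝒜 ℱ ↔ WordRule φ Φ 𝒜 ℱ := by
  rw [BPrimeFree, WeaklyBPrimeFree, free_iff_freeWords, cyclicAntimonotone_iff,
    triviallyIndependent_iff φ Φ 𝒜 ℱ]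
  constructor
  · rintro ⟨⟨hA, hC⟩, hT⟩
    have core : ∀ (p q : List (I × A)) (w : List ((I × A) ⊕ (J × F))), IsReduced φ 𝒜 p →
        IsReduced φ 𝒜 q → IsCore φ 𝒜 ℱ w →
        phi' A Φ (eval (p.map Sum.inl ++ (w ++ q.map Sum.inl))) =
          pairing φ p.reverse q * phi' A Φ (twinEval w).2 := by
      intro p q w hp hq hw
      obtain ⟨f, L, hf, hL, e⟩ := hw.exists_midWord hφ hA
      have := hC _ (prod_mem_iSup hp) _ (prod_mem_iSup hq) f hf L hL
      have hpq := hA.apply_reverse_mul hφ (isReduced_reverse.2 hp) hq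
      rw [List.reverse_reverse] at hpq
      rw [← e, twinEval_fst, hpq] at this
      rw [← this, eval_append, eval_append, eval_map_inl, eval_map_inl, mul_assoc]
    refine ⟨hA, fun p q y hw => ?_, fun p q y z w hw => ?_⟩
    · obtain ⟨hp, hq, -⟩ := isWord_append.1 hw
      have hq' := isWord_cons.1 hq
      have := core p q [.inr y] (isWord_map_inl.1 hp) (isWord_map_inl.1 hq'.2.2)
        ⟨⟨⟨List.isChain_singleton _, by simpa using hq'.1⟩, by simp, by simp⟩, by simp⟩
      simpa using this
    · have e : p.map Sum.inl ++ Sum.inr y :: (w ++ Sum.inr z :: q.map Sum.inl) =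
          p.map Sum.inl ++ ((Sum.inr y :: (w ++ [Sum.inr z])) ++ q.map Sum.inl) := by simp
      rw [e] at hw ⊢
      obtain ⟨hp, hq, -⟩ := isWord_append.1 hw
      obtain ⟨hw, hq, -⟩ := isWord_append.1 hq
      rw [core p q _ (isWord_map_inl.1 hp) (isWord_map_inl.1 hq)
        ⟨⟨hw, by simp, by simp [List.getLast?_cons]⟩, by simp⟩]
      by_cases hr : ∀ x ∈ Sum.inr y :: (w ++ [Sum.inr z]), x.isRight
      · rw [twinEval_snd_of_forall hr, hT y z w hw fun x hx => hr x (by simp [hx]), mul_zero]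
      · rw [twinEval_snd_of_exists hr, map_zero, mul_zero]
  · intro h
    refine ⟨⟨h.free, fun a ha b hb f hf L hL => ?_⟩, fun y z w hw _ => ?_⟩
    · have hv := midWord_mem_span hφ h.free hf hL
      generalize midWord φ f L = v at hv ⊢
      induction hv using Submodule.span_induction with
      | mem v hv =>
        obtain ⟨w, hw, rfl⟩ := hv
        rw [twinEval_fst]
        exact h.core hφ ha hb hw
      | zero => simp only [Prod.fst_zero, Prod.snd_zero, mul_zero, zero_mul, map_zero]
      | add u v _ _ hu hv =>
        simp only [Prod.fst_add, Prod.snd_add, mul_add, add_mul, map_add, hu, hv]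
      | smul c u _ hu =>
        simp only [Prod.smul_fst, Prod.smul_snd, mul_smul_comm, smul_mul_assoc, map_smul, hu,
          smul_eq_mul, mul_left_comm]
    · simpa using h.multi [] [] y z w (by simpa using hw)

/-! ### Infinitesimal freeness on centred words -/

/-- The formula for `φ'` in the definition of infinitesimal freeness, for a single word. -/
def MirrorFormula {B : Type*} [Ring B] [Algebra ℂ B] (φ φ' : B →ₗ[ℂ] ℂ) {K : Type*} {n : ℕ}
    (hn : 0 < n) (i : Fin n → K) (b : Fin n → B) : Prop :=
  ((Odd n ∧ ∀ k, i k = i k.rev) →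
    φ' (List.ofFn b).prod =
      (∏ k : Fin (n / 2),
          φ (b (k.castLE (Nat.div_le_self n 2)) * b (k.castLE (Nat.div_le_self n 2)).rev)) *
        φ' (b ⟨n / 2, Nat.div_lt_self hn one_lt_two⟩)) ∧
  (¬ (Odd n ∧ ∀ k, i k = i k.rev) → φ' (List.ofFn b).prod = 0)

section

variable {B : Type*} [Ring B] [Algebra ℂ B] {φ φ' : B →ₗ[ℂ] ℂ} {K : Type*} {n : ℕ}

theorem mirrorFormula_iff_of_middle (hn : 0 < n) (i : Fin n → K) (b : Fin n → B)
    (h : φ' (b ⟨n / 2, Nat.div_lt_self hn one_lt_two⟩) = 0) :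
    MirrorFormula φ φ' hn i b ↔ φ' (List.ofFn b).prod = 0 := by
  rw [MirrorFormula, h, mul_zero]
  tauto

/-- A letter outside the middle which lies in a two-sided ideal annihilated by `φ` makes the product
in the formula vanish. -/
theorem mirrorFormula_iff_of_null (hn : 0 < n) (i : Fin n → K) (b : Fin n → B) (k : Fin n)
    (hk : 2 * (k : ℕ) + 1 ≠ n) (hl : ∀ x, φ (b k * x) = 0) (hr : ∀ x, φ (x * b k) = 0) :
    MirrorFormula φ φ' hn i b ↔ φ' (List.ofFn b).prod = 0 := by
  by_cases ho : Odd n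
  · have h0 : (∏ k : Fin (n / 2),
        φ (b (k.castLE (Nat.div_le_self n 2)) * b (k.castLE (Nat.div_le_self n 2)).rev)) = 0 := by
      obtain ⟨m, rfl⟩ := ho
      rcases lt_or_gt_of_ne hk with h | h
      · exact Finset.prod_eq_zero (Finset.mem_univ ⟨k, by omega⟩) (hl _)
      · have hk' := k.2
        refine Finset.prod_eq_zero
          (Finset.mem_univ (⟨2 * m - k, by omega⟩ : Fin ((2 * m + 1) / 2))) ?_
        have : ((⟨2 * m - k, by omega⟩ : Fin ((2 * m + 1) / 2)).castLE
            (Nat.div_le_self _ 2)).rev = k := by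
          ext
          simp only [Fin.val_rev, Fin.val_castLE]
          omega
        rw [this]
        exact hr _
    rw [MirrorFormula, h0, zero_mul]
    tauto
  · simp [MirrorFormula, ho]

end

variable (𝒜 ℱ) in
/-- The family of all `𝒜 i ⊕ 0` and all `ℂ 1 ⊕ ℱ j`. -/
abbrev assocFamily : I ⊕ J → Subalgebra ℂ (Assoc A F) :=
  Sum.elim (fun i => mainSubalgebra F (𝒜 i)) fun j => pertSubalgebra A (ℱ j)

theorem IsLetter.mem {x : (I × A) ⊕ (J × F)} (h : IsLetter φ 𝒜 ℱ x) :
    letter x ∈ assocFamily 𝒜 ℱ (index x) ∧ phi F φ (letter x) = 0 := by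
  cases x with
  | inl x => exact ⟨⟨h.1, rfl⟩, h.2⟩
  | inr y => exact ⟨⟨⟨0, (zero_smul ℂ (1 : A)).symm⟩, h⟩, map_zero φ⟩

theorem exists_isLetter (hφ : φ 1 = 1) {k : I ⊕ J} {b : Assoc A F}
    (hb : b ∈ assocFamily 𝒜 ℱ k ∧ phi F φ b = 0) :
    ∃ x, IsLetter φ 𝒜 ℱ x ∧ index x = k ∧ letter x = b := by
  obtain ⟨hb, h0⟩ := hb
  cases k with
  | inl i => exact ⟨.inl (i, b.main), ⟨hb.1, h0⟩, rfl, Assoc.ext rfl hb.2.symm⟩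
  | inr j =>
    obtain ⟨⟨c, hc⟩, hb⟩ := hb
    refine ⟨.inr (j, b.pert), hb, rfl, Assoc.ext ?_ rfl⟩
    rw [phi_apply, hc, map_smul, hφ, smul_eq_mul, mul_one] at h0
    rw [hc, h0, zero_smul]
    rfl

theorem ofFn_letter (w : List ((I × A) ⊕ (J × F))) :
    (List.ofFn fun k : Fin w.length => letter w[k]).prod = eval w := by
  rw [eval]
  congr 1
  exact List.ext_getElem (by simp) (by simp)

/-- Infinitesimal freeness in terms of lists of letters. -/
theorem infinitesimallyFree_iff (hφ : φ 1 = 1) (Φ : F →ₗ[ℂ] ℂ) :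
    InfinitesimallyFree (phi F φ) (phi' A Φ) (assocFamily 𝒜 ℱ) ↔
      ∀ (w : List ((I × A) ⊕ (J × F))) (hw : 0 < w.length), IsWord φ 𝒜 ℱ w →
        phi F φ (eval w) = 0 ∧ MirrorFormula (phi F φ) (phi' A Φ) hw
          (fun k => index w[k]) (fun k => letter w[k]) := by
  constructor
  · intro h w hn hw
    have := h w.length (fun k => index w[k]) (fun k => letter w[k]) hn
      (fun k l hkl => by
        have := List.isChain_iff_getElem.1 hw.1 k (by omega)
        simpa [hkl] using this)
      (fun k => (hw.2 _ (List.getElem_mem _)).mem)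
    exact ⟨ofFn_letter w ▸ this.1, this.2⟩
  · intro h n i b hn hi hb
    obtain ⟨w, hw, e⟩ : ∃ (w : List ((I × A) ⊕ (J × F))) (hw : w.length = n),
        ∀ k : Fin n, IsLetter φ 𝒜 ℱ (w[(k : ℕ)]'(hw ▸ k.2)) ∧
          index (w[(k : ℕ)]'(hw ▸ k.2)) = i k ∧ letter (w[(k : ℕ)]'(hw ▸ k.2)) = b k := by
      choose x hx using fun k => exists_isLetter hφ (hb k)
      exact ⟨List.ofFn x, by simp, fun k => by simpa using hx k⟩
    subst hw
    obtain rfl : (fun k : Fin w.length => index w[k]) = i := funext fun k => (e k).2.1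
    obtain rfl : (fun k : Fin w.length => letter w[k]) = b := funext fun k => (e k).2.2
    have := h w hn ⟨List.isChain_iff_getElem.2 fun k hk => hi ⟨k, by omega⟩ ⟨k + 1, hk⟩ rfl,
      fun x hx => by
        obtain ⟨k, hk, rfl⟩ := List.getElem_of_mem hx
        exact (e ⟨k, hk⟩).1⟩
    exact ⟨(ofFn_letter w).symm ▸ this.1, this.2⟩

theorem phi_ofPert_mul (φ : A →ₗ[ℂ] ℂ) (f : F) (x : Assoc A F) :
    phi F φ (ofPert A f * x) = 0 := by simp

theorem phi_mul_ofPert (φ : A →ₗ[ℂ] ℂ) (f : F) (x : Assoc A F) :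
    phi F φ (x * ofPert A f) = 0 := by simp

theorem pairing_of_map_eq (φ : A →ₗ[ℂ] ℂ) {p q : List (I × A)} (hlen : p.length = q.length)
    (h : p.map Prod.fst = q.map Prod.fst) :
    pairing φ p q = ∏ k : Fin p.length, φ (p[k].2 * (q[(k : ℕ)]'(hlen ▸ k.2)).2) := by
  induction p generalizing q with
  | nil =>
    cases q with
    | nil => simp [pairing]
    | cons y q => simp at h
  | cons x p ih =>
    cases q with
    | nil => simp at h
    | cons y q =>
      rw [List.map_cons, List.map_cons, List.cons.injEq] at h
      rw [pairing, if_pos h.1, ih (by simpa using hlen) h.2]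
      exact (Fin.prod_univ_succ (n := p.length) fun k =>
        φ ((x :: p)[k].2 * ((y :: q)[(k : ℕ)]'(hlen ▸ k.2)).2)).symm

theorem pairing_of_map_ne (φ : A →ₗ[ℂ] ℂ) {p q : List (I × A)}
    (h : p.map Prod.fst ≠ q.map Prod.fst) : pairing φ p q = 0 := by
  induction p generalizing q with
  | nil =>
    cases q with
    | nil => simp at h
    | cons y q => rw [pairing]
  | cons x p ih =>
    cases q with
    | nil => rw [pairing]
    | cons y q =>
      by_cases hxy : x.1 = y.1
      · rw [pairing, ih (by simpa [hxy] using h), mul_zero, ite_self]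
      · rw [pairing, if_neg hxy]

/-- For a word with exactly one letter from `F` the formula of infinitesimal freeness is a
pairing. -/
theorem mirrorFormula_single (φ : A →ₗ[ℂ] ℂ) (Φ : F →ₗ[ℂ] ℂ) (p q : List (I × A)) (y : J × F)
    {w : List ((I × A) ⊕ (J × F))} (e : w = p.map Sum.inl ++ .inr y :: q.map Sum.inl)
    (hw : 0 < w.length) :
    MirrorFormula (phi F φ) (phi' A Φ) hw (fun k => index w[k]) (fun k => letter w[k]) ↔
      phi' A Φ (eval w) = pairing φ p.reverse q * Φ y.2 := by
  have hlen : w.length = p.length + q.length + 1 := by simp [e]; omega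
  have hm : w[p.length]'(by omega) = .inr y := by simp [e]
  by_cases hpq : p.length = q.length
  · have hl : ∀ k (h : k < p.length), w[k]'(by omega) = .inl p[k] := by
      intro k h
      simp [e, h]
    have hr : ∀ k (h : k < q.length), w[p.length + 1 + k]'(by omega) = .inl q[k] := by
      intro k h
      simp [e, List.getElem_append, List.getElem_cons, show ¬ p.length + 1 + k < p.length by omega,
        show ¬ p.length + 1 + k - p.length = 0 by omega,
        show p.length + 1 + k - p.length - 1 = k by omega]
    have hr' : ∀ k (h : k < p.length) (hk : w.length - (k + 1) < w.length),
        w[w.length - (k + 1)]'hk = .inl (q[p.length - 1 - k]'(by omega)) := by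
      intro k h hk
      rw [← hr _ (by omega)]
      congr 1
      omega
    have hcond : (Odd w.length ∧ ∀ k : Fin w.length, index w[k] = index w[k.rev]) ↔
        p.reverse.map Prod.fst = q.map Prod.fst := by
      constructor
      · rintro ⟨-, h⟩
        refine List.ext_getElem (by simp [hpq]) fun k h1 h2 => ?_
        simp only [List.length_map, List.length_reverse] at h1 h2
        have := h ⟨p.length - 1 - k, by omega⟩
        simp only [Fin.getElem_fin, Fin.val_rev] at this
        rw [hl _ (by omega), hr' _ (by omega)] at this
        simpa [index, show p.length - 1 - (p.length - 1 - k) = k by omega] using this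
      · intro h
        have key : ∀ k (h : k < p.length), p[k].1 = (q[p.length - 1 - k]'(by omega)).1 := by
          intro k hk
          have := List.getElem_of_eq h (i := p.length - 1 - k) (by simp; omega)
          simpa [show p.length - 1 - (p.length - 1 - k) = k by omega] using this
        have key' : ∀ k (h : k < p.length),
            index (w[k]'(by omega)) = index (w[w.length - (k + 1)]'(by omega)) := by
          intro k hk
          rw [hl _ hk, hr' _ hk]
          simpa [index] using key k hk
        refine ⟨⟨p.length, by omega⟩, fun k => ?_⟩
        have hk := k.2
        simp only [Fin.getElem_fin, Fin.val_rev]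
        rcases lt_trichotomy (k : ℕ) p.length with h | h | h
        · exact key' k h
        · congr 2
          omega
        · have := key' (w.length - (k + 1)) (by omega)
          rw [this]
          congr 2
          omega
    rw [MirrorFormula, ofFn_letter, hcond]
    have hmid : letter (w[w.length / 2]'(by omega)) = ofPert A y.2 := by
      have : w[w.length / 2]'(by omega) = .inr y := by
        rw [← hm]
        congr 1
        omega
      rw [this]
      rfl
    by_cases h : p.reverse.map Prod.fst = q.map Prod.fst
    · have hprod : (∏ k : Fin (w.length / 2), phi F φ
          (letter w[k.castLE (Nat.div_le_self _ 2)] *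
            letter w[(k.castLE (Nat.div_le_self _ 2)).rev])) = pairing φ p.reverse q := by
        rw [pairing_of_map_eq φ (by simpa using hpq) h]
        -- The pairing counts positions from the middle, the formula counts them from the ends.
        refine Fintype.prod_equiv ((finCongr (by simp; omega)).trans Fin.revPerm) _ _ fun k => ?_
        have hk := k.2
        simp only [Fin.getElem_fin, Fin.val_rev, Fin.val_castLE, Equiv.trans_apply,
          Fin.revPerm_apply, finCongr_apply, Fin.val_cast, List.getElem_reverse]
        rw [hl _ (by omega), hr' _ (by omega)]
        simp only [letter, ← map_mul, phi_apply, main_ofMain, List.length_reverse]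
        congr! 4 <;> omega
      rw [hprod]
      simp [h, hmid]
    · rw [pairing_of_map_ne φ h, zero_mul]
      tauto
  · have hne : 2 * p.length + 1 ≠ w.length := by omega
    have h0 : pairing φ p.reverse q = 0 := pairing_of_map_ne φ fun h =>
      hpq (by simpa using congrArg List.length h)
    rw [mirrorFormula_iff_of_null hw _ _ ⟨p.length, by omega⟩ hne, ofFn_letter, h0, zero_mul]
    · intro x
      simp only [Fin.getElem_fin, hm]
      exact phi_ofPert_mul φ _ _
    · intro x
      simp only [Fin.getElem_fin, hm]
      exact phi_mul_ofPert φ _ _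

theorem phi_eval_of_inr (φ : A →ₗ[ℂ] ℂ) (v w : List ((I × A) ⊕ (J × F))) (y : J × F) :
    phi F φ (eval (v ++ .inr y :: w)) = 0 := by
  simp [letter]

theorem infinitesimallyFree_iff_wordRule (hφ : φ 1 = 1) (Φ : F →ₗ[ℂ] ℂ) :
    InfinitesimallyFree (phi F φ) (phi' A Φ) (assocFamily 𝒜 ℱ) ↔ WordRule φ Φ 𝒜 ℱ := by
  rw [infinitesimallyFree_iff hφ]
  have multi : ∀ (p q : List (I × A)) (y z : J × F) (v w : List ((I × A) ⊕ (J × F)))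
      (_ : w = p.map Sum.inl ++ .inr y :: (v ++ .inr z :: q.map Sum.inl)) (hw : 0 < w.length),
      MirrorFormula (phi F φ) (phi' A Φ) hw (fun k => index w[k]) (fun k => letter w[k]) ↔
        phi' A Φ (eval w) = 0 := by
    intro p q y z v w e hw
    have hlen : w.length = p.length + v.length + q.length + 2 := by simp [e]; omega
    have h1 : w[p.length]'(by omega) = .inr y := by simp [e]
    have h2 : w[p.length + 1 + v.length]'(by omega) = .inr z := by
      simp [e, List.getElem_append, List.getElem_cons,
        show ¬ p.length + 1 + v.length < p.length by omega,
        show ¬ p.length + 1 + v.length - p.length = 0 by omega,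
        show p.length + 1 + v.length - p.length - 1 = v.length by omega]
    have main : ∀ (k : ℕ) (hk : k < w.length) (f : J × F), w[k] = .inr f → 2 * k + 1 ≠ w.length →
        (MirrorFormula (phi F φ) (phi' A Φ) hw (fun k => index w[k]) (fun k => letter w[k]) ↔
          phi' A Φ (eval w) = 0) := by
      intro k hk f hf hne
      rw [mirrorFormula_iff_of_null hw _ _ ⟨k, hk⟩ hne, ofFn_letter]
      · intro x
        simp only [Fin.getElem_fin, hf]
        exact phi_ofPert_mul φ _ _
      · intro x
        simp only [Fin.getElem_fin, hf]
        exact phi_mul_ofPert φ _ _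
    -- At most one of two letters from `F` is in the middle of the word.
    by_cases hk : 2 * p.length + 1 = w.length
    · exact main _ _ z h2 (by omega)
    · exact main _ _ y h1 hk
  constructor
  · intro h
    refine ⟨fun p hp h0 => ?_, fun p q y hw => ?_, fun p q y z v hw => ?_⟩
    · have := (h (p.map Sum.inl) (by simpa [List.length_pos_iff] using h0)
        (isWord_map_inl.2 hp)).1
      simpa using this
    · exact (mirrorFormula_single φ Φ p q y rfl (by simp)).1 (h _ (by simp) hw).2
    · exact (multi p q y z v _ rfl (by simp)).1 (h _ (by simp) hw).2
  · intro h w hn hw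
    rcases word_cases w with ⟨p, rfl⟩ | ⟨p, y, q, rfl⟩ | ⟨p, y, v, z, q, rfl⟩
    · refine ⟨?_, ?_⟩
      · simpa using h.free p (isWord_map_inl.1 hw) (by simpa [List.length_pos_iff] using hn)
      · rw [mirrorFormula_iff_of_middle, ofFn_letter]
        · simp
        · simp [letter]
    · exact ⟨phi_eval_of_inr φ _ _ _, (mirrorFormula_single φ Φ p q y rfl hn).2 (h.single p q y hw)⟩
    · exact ⟨phi_eval_of_inr φ _ _ _, (multi p q y z v _ rfl hn).2 (h.multi p q y z v hw)⟩

theorem bPrimeFree_iff_infinitesimallyFree (hφ : φ 1 = 1) (Φ : F →ₗ[ℂ] ℂ) :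
    BPrimeFree φ Φ 𝒜 ℱ ↔
      InfinitesimallyFree (phi F φ) (phi' A Φ) (assocFamily 𝒜 ℱ) := by
  rw [bPrimeFree_iff_wordRule hφ, infinitesimallyFree_iff_wordRule hφ]

/-- With a single subalgebra of `F` there are no alternating words of length at least two, so that
trivial independence holds automatically. -/
theorem weaklyBPrimeFree_iff (Φ : F →ₗ[ℂ] ℂ) :
    WeaklyBPrimeFree φ Φ 𝒜 ℱ ↔ BPrimeFree φ Φ 𝒜 (fun _ : Unit => ⨆ j, ℱ j) := by
  have : TriviallyIndependent Φ (fun _ : Unit => ⨆ j, ℱ j) := fun n j f hj _ =>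
    absurd rfl (hj 0 1 rfl)
  rw [BPrimeFree, WeaklyBPrimeFree, WeaklyBPrimeFree, iSup_const]
  tauto

end BPrime

theorem theorem3p4 {A F : Type*} [Ring A] [Algebra ℂ A]
    [NonUnitalRing F] [Module ℂ F] [IsScalarTower ℂ F F] [SMulCommClass ℂ F F]
    [Module A F] [Module Aᵐᵒᵖ F] [IsScalarTower ℂ A F] [IsScalarTower ℂ Aᵐᵒᵖ F]
    [BPrime.IsAlgebraOver A F]
    (φ : A →ₗ[ℂ] ℂ) (hφ : φ 1 = 1) (Φ : F →ₗ[ℂ] ℂ)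
    {I J : Type*} (𝒜 : I → Subalgebra ℂ A) (ℱ : J → NonUnitalSubalgebra ℂ F) :
    (BPrime.BPrimeFree φ Φ 𝒜 ℱ ↔
      BPrime.InfinitesimallyFree (BPrime.Assoc.phi F φ) (BPrime.Assoc.phi' A Φ)
        (Sum.elim (fun i : I => BPrime.Assoc.mainSubalgebra F (𝒜 i))
          (fun j : J => BPrime.Assoc.pertSubalgebra A (ℱ j)))) ∧
    (BPrime.Assoc.pertSubalgebra A (⨆ j, ℱ j) = ⨆ j, BPrime.Assoc.pertSubalgebra A (ℱ j)) ∧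
    (BPrime.WeaklyBPrimeFree φ Φ 𝒜 ℱ ↔
      BPrime.InfinitesimallyFree (BPrime.Assoc.phi F φ) (BPrime.Assoc.phi' A Φ)
        (Sum.elim (fun i : I => BPrime.Assoc.mainSubalgebra F (𝒜 i))
          (fun _ : Unit => BPrime.Assoc.pertSubalgebra A (⨆ j, ℱ j)))) :=
  ⟨BPrime.bPrimeFree_iff_infinitesimallyFree hφ Φ, BPrime.pertSubalgebra_iSup ℱ,
    (BPrime.weaklyBPrimeFree_iff Φ).trans (BPrime.bPrimeFree_iff_infinitesimallyFree hφ Φ)⟩
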